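/- Let $\mathbb K=\mathbb R$ or $\mathbb C$, and let $H=O(d)$ if $\mathbb K=\mathbb R$, $H=U(d)$ if $\mathbb K=\mathbb C$. A connection graph $(G,\sigma)$ is a locally finite weighted graph $G=(V,w,\mu)$ (with $\mu:V\to(0,\infty)$, $w\ge 0$ symmetric with $w_{xx}=0$, and $x\sim y$ iff $w_{xy}\neq0$) together with $\sigma_{xy}\in H$ for each oriented edge, $\sigma_{xy}=\sigma_{yx}^{-1}$. Put $p_{xy}=w_{xy}/\mu_x$, let $\Delta F(x)=\sum_{y\sim x}p_{xy}(F(y)-F(x))$ for $F:V\to\mathbb K$ and $\Delta^\sigma f(x)=\sum_{y\sim x}p_{xy}(\sigma_{xy}f(y)-f(x))$ for $f:V\to\mathbb K^d$, and $$2\Gamma^\sigma(f,g)=\Delta(f^\top\overline g)-f^\top\overline{\Delta^\sigma g}-(\Delta^\sigma f)^\top\overline g,\qquad 2\Gamma_2^\sigma(f,g)=\Delta(\Gamma^\sigma(f,g))-\Gamma^\sigma(f,\Delta^\sigma g)-\Gamma^\sigma(\Delta^\sigma f,g).$$ For $N\in(0,\infty]$ the curvature $\mathcal K_{G,\sigma,x}(N)$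 is the largest $K$ such that $\Gamma_2^\sigma(f,f)(x)\ge\frac1N|\Delta^\sigma f(x)|^2+K\,\Gamma^\sigma(f,f)(x)$ for all $f:V\to\mathbb K^d$ (with $1/\infty=0$, and with value $+\infty$ if every real $K$ is admissible, as at an isolated vertex). Let $B_2^{inc}(x)$ be the subgraph induced on the ball of radius $2$ around $x$, with the edges joining two vertices at distance exactly $2$ from $x$ removed, and with the restricted connection; it is balanced if $\sigma_{x_0x_1}\sigma_{x_1x_2}\cdots\sigma_{x_nx_0}=I_d$ for each of its cycles $x_0\sim x_1\sim\dots\sim x_n\sim x_0$. The signature group of $(G,\sigma)$ is the subgroup of $H$ generated by all $\sigma_{xy}$, $x\sim y$. Let $(G,\sigma)$, $(G',\sigma')$ be connection graphs with the same $\mathbb K$ and $d$, and let $\alpha,\beta>0$. Their Cartesian product $(G\times_{\alpha,\beta}G',\sigma^\times)$ has vertex set $V\times V'$, measure $\mu_{(x,x')}=\mu_x\mu'_{x'}$, weights $w_{(x,x')(y,x')}=\alpha w_{xy}\mu'_{x'}$, $w_{(x,x')(x,y')}=\beta w'_{x'y'}\mu_x$ and zero otherwise, and connection $\sigma^\times_{(x,x')(y,x')}=\sigma_{xy}$,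 $\sigma^\times_{(x,x')(x,y')}=\sigma'_{x'y'}$. Suppose that every element of the signature group of $(G,\sigma)$ commutes with every element of that of $(G',\sigma')$. Then for all $x\in V$, $x'\in V'$ and $N,N'\in(0,\infty]$, $$\mathcal K_{G\times_{\alpha,\beta}G',\sigma^\times,(x,x')}(N+N')\ \ge\ \min\{\alpha\,\mathcal K_{G,\sigma,x}(N),\ \beta\,\mathcal K_{G',\sigma',x'}(N')\}.$$ If moreover $B_2^{inc}(x)$ or $B_2^{inc}(x')$ is balanced, then $$\mathcal K_{G\times_{\alpha,\beta}G',\sigma^\times,(x,x')}(\infty)=\min\{\alpha\,\mathcal K_{G,\sigma,x}(\infty),\ \beta\,\mathcal K_{G',\sigma',x'}(\infty)\}.$$ -/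

import Mathlib

/-- A locally finite weighted graph `(V, w, μ)`: a positive vertex measure `μ` and a symmetric
nonnegative edge weight `w` vanishing on the diagonal.  The vertices `x`, `y` are adjacent when
`w x y ≠ 0`, and every vertex has finitely many neighbours. -/
structure WeightedGraph (V : Type*) where
  /-- edge weight -/
  w : V → V → ℝ
  /-- vertex measure -/
  μ : V → ℝ
  w_nonneg : ∀ x y, 0 ≤ w x y
  w_symm : ∀ x y, w x y = w y x
  w_self : ∀ x, w x x = 0
  μ_pos : ∀ x, 0 < μ x
  finite_nbr : ∀ x, {y | w x y ≠ 0}.Finite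

namespace WeightedGraph

variable {V : Type*} (G : WeightedGraph V)

/-- The underlying combinatorial graph. -/
def graph : SimpleGraph V where
  Adj x y := G.w x y ≠ 0
  symm := ⟨fun x y h => by rwa [G.w_symm y x]⟩
  loopless := ⟨fun x h => h (G.w_self x)⟩

/-- The transition rate `p_{xy} = w_{xy} / μ_x`. -/
noncomputable def p (x y : V) : ℝ := G.w x y / G.μ x

/-- The `1`-sphere `S_1(x)`, i.e. the finite set of neighbours of `x`. -/
noncomputable def nbr (x : V) : Finset V := (G.finite_nbr x).toFinset

/-- The Laplacian `Δ F (x) = ∑_{y ∼ x} p_{xy} (F(y) - F(x))` on scalar functions. -/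
noncomputable def lap {𝕜 : Type*} [RCLike 𝕜] (F : V → 𝕜) (x : V) : 𝕜 :=
  ∑ y ∈ G.nbr x, (G.p x y : 𝕜) * (F y - F x)

/-- The incomplete `2`-ball `B_2^{inc}(x)`: the subgraph induced on the ball `B_2(x)` with the edges
joining two vertices of the sphere `S_2(x)` removed.  It is written as a graph on `V` whose vertices
outside `B_2(x)` are isolated (`edist` is the graph distance, infinite between components). -/
def incBall (x : V) : SimpleGraph V where
  Adj u v := G.graph.Adj u v ∧ G.graph.edist x u ≤ 2 ∧ G.graph.edist x v ≤ 2 ∧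
    ¬ (G.graph.edist x u = 2 ∧ G.graph.edist x v = 2)
  symm := ⟨fun _ _ h => ⟨h.1.symm, h.2.2.1, h.2.1, fun h' => h.2.2.2 ⟨h'.2, h'.1⟩⟩⟩
  loopless := ⟨fun u h => G.graph.loopless.irrefl u h.1⟩

open Classical in
/-- The Cartesian product `G ×_{α,β} G'` of weighted graphs: `w_{(x,x')(y,x')} = α w_{xy} μ'_{x'}`,
`w_{(x,x')(x,y')} = β w'_{x'y'} μ_x`, all other weights vanish, and `μ_{(x,x')} = μ_x μ'_{x'}`. (On
the diagonal both summands vanish.) -/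
noncomputable def cart {V' : Type*} (G' : WeightedGraph V') (α β : ℝ) (hα : 0 < α) (hβ : 0 < β) :
    WeightedGraph (V × V') where
  w a b := (if a.2 = b.2 then α * G.w a.1 b.1 * G'.μ a.2 else 0) +
    (if a.1 = b.1 then β * G'.w a.2 b.2 * G.μ a.1 else 0)
  μ a := G.μ a.1 * G'.μ a.2
  w_nonneg a b := by
    have h1 := G.w_nonneg a.1 b.1
    have h2 := G'.w_nonneg a.2 b.2
    have h3 := (G.μ_pos a.1).le
    have h4 := (G'.μ_pos a.2).le
    have h5 := hα.le
    have h6 := hβ.le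
    split_ifs <;> positivity
  w_symm a b := by
    obtain ⟨a, a'⟩ := a
    obtain ⟨b, b'⟩ := b
    dsimp only
    congr 1
    · by_cases h : a' = b'
      · subst h; simp [G.w_symm a b]
      · rw [if_neg h, if_neg (Ne.symm h)]
    · by_cases h : a = b
      · subst h; simp [G'.w_symm a' b']
      · rw [if_neg h, if_neg (Ne.symm h)]
  w_self a := by simp [G.w_self, G'.w_self]
  μ_pos a := mul_pos (G.μ_pos _) (G'.μ_pos _)
  finite_nbr a := by
    refine (((G.finite_nbr a.1).image (fun y => (y, a.2))).union
      ((G'.finite_nbr a.2).image (fun y' => (a.1, y')))).subset ?_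
    rintro ⟨b, b'⟩ h
    simp only [Set.mem_ofPred_eq, Set.mem_union, Set.mem_image] at h ⊢
    by_contra hc
    push Not at hc
    apply h
    have e1 : (if a.2 = b' then α * G.w a.1 b * G'.μ a.2 else 0) = 0 := by
      split_ifs with hb
      · have : G.w a.1 b = 0 := by
          by_contra hw
          exact hc.1 b hw (by rw [hb])
        simp [this]
      · rfl
    have e2 : (if a.1 = b then β * G'.w a.2 b' * G.μ a.1 else 0) = 0 := by
      split_ifs with hb
      · have : G'.w a.2 b' = 0 := by
          by_contra hw
          exact hc.2 b' hw (by rw [hb])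
        simp [this]
      · rfl
    rw [e1, e2, add_zero]

end WeightedGraph

/-- A connection graph with `d`-dimensional connections over `𝕜 = ℝ` or `ℂ`: each oriented edge
carries `σ_{xy}` in `O(d)` (for `𝕜 = ℝ`) or `U(d)` (for `𝕜 = ℂ`), with `σ_{xy} = σ_{yx}⁻¹`.
The values of `σ` on pairs that are not edges carry no meaning and are never used. -/
structure ConnectionGraph (𝕜 : Type*) [RCLike 𝕜] (d : ℕ) (V : Type*) extends WeightedGraph V where
  /-- connection -/
  σ : V → V → Matrix.unitaryGroup (Fin d) 𝕜
  σ_inv : ∀ x y, w x y ≠ 0 → σ x y = (σ y x)⁻¹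

namespace ConnectionGraph

open scoped Matrix

variable {𝕜 : Type*} [RCLike 𝕜] {d : ℕ} {V : Type*} (G : ConnectionGraph 𝕜 d V)

/-- The connection Laplacian `Δ^σ f (x) = ∑_{y ∼ x} p_{xy} (σ_{xy} f(y) - f(x))`. -/
noncomputable def clap (f : V → Fin d → 𝕜) (x : V) : Fin d → 𝕜 :=
  ∑ y ∈ G.nbr x, (G.p x y : 𝕜) • ((G.σ x y : Matrix (Fin d) (Fin d) 𝕜) *ᵥ f y - f x)

/-- `2 Γ^σ(f,g) = Δ(fᵀ ḡ) - fᵀ conj(Δ^σ g) - (Δ^σ f)ᵀ ḡ`. -/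
noncomputable def Γ (f g : V → Fin d → 𝕜) (x : V) : 𝕜 :=
  (G.lap (fun y => f y ⬝ᵥ star (g y)) x - f x ⬝ᵥ star (G.clap g x) - G.clap f x ⬝ᵥ star (g x)) / 2

/-- `2 Γ_2^σ(f,g) = Δ(Γ^σ(f,g)) - Γ^σ(f, Δ^σ g) - Γ^σ(Δ^σ f, g)`. -/
noncomputable def Γ₂ (f g : V → Fin d → 𝕜) (x : V) : 𝕜 :=
  (G.lap (G.Γ f g) x - G.Γ f (G.clap g) x - G.Γ (G.clap f) g x) / 2

/-- The curvature dimension inequality `CD^σ(K, N)` at the vertex `x`, for `K ∈ ℝ`, `N ∈ (0, ∞]`: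
`Γ_2^σ(f,f)(x) ≥ (1/N) |Δ^σ f(x)|² + K Γ^σ(f,f)(x)` for all `f : V → 𝕜^d`, where `1/∞ = 0` and
`|·|` is the Euclidean norm.  (`Γ^σ(f,f)` and `Γ_2^σ(f,f)` are real valued, so taking the real
part only changes the type.) -/
def CD (x : V) (K : ℝ) (N : ENNReal) : Prop :=
  ∀ f : V → Fin d → 𝕜,
    (N⁻¹).toReal * (∑ i, ‖G.clap f x i‖ ^ 2) + K * RCLike.re (G.Γ f f x) ≤
      RCLike.re (G.Γ₂ f f x)

/-- The `N`-Bakry-Émery curvature at `x`, the largest `K` with `CD^σ(K, N)` at `x`, as an extended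
real: it is `+∞` when `CD^σ(K, N)` holds for every real `K` (e.g. at an isolated vertex).
By `curvature_eq_coe_iff` below it has a real value `k` exactly if `k` is the largest such `K`. -/
noncomputable def curvature (x : V) (N : ENNReal) : EReal :=
  sSup ((fun K : ℝ => (K : EReal)) '' {K : ℝ | G.CD x K N})

theorem curvature_eq_coe_iff (x : V) (N : ENNReal) (k : ℝ) :
    G.curvature x N = (k : EReal) ↔ IsGreatest {K : ℝ | G.CD x K N} k := by
  constructor
  · intro h
    have hub : ∀ K : ℝ, G.CD x K N → K ≤ k := fun K hK => by
      have : (K : EReal) ≤ G.curvature x N := le_sSup ⟨K, hK, rfl⟩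
      rw [h] at this
      exact_mod_cast this
    refine ⟨?_, hub⟩
    have happrox : ∀ ε : ℝ, 0 < ε → ∃ K, G.CD x K N ∧ k - ε < K := fun ε hε => by
      have hlt : ((k - ε : ℝ) : EReal) < G.curvature x N := by
        rw [h]; exact_mod_cast sub_lt_self k hε
      obtain ⟨_, ⟨K, hK, rfl⟩, hlt'⟩ := lt_sSup_iff.mp hlt
      exact ⟨K, hK, EReal.coe_lt_coe_iff.mp hlt'⟩
    intro f
    by_contra hc
    push Not at hc
    set A := (N⁻¹).toReal * (∑ i, ‖G.clap f x i‖ ^ 2)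
    set B := RCLike.re (G.Γ f f x)
    set C := RCLike.re (G.Γ₂ f f x)
    have hpos : 0 < (A + k * B - C) / (|B| + 1) := by
      apply div_pos <;> [linarith; positivity]
    obtain ⟨K, hK, hlt⟩ := happrox _ hpos
    have h1 : A + K * B ≤ C := hK f
    have h2 : K ≤ k := hub K hK
    have h3 : (k - K) * (|B| + 1) < A + k * B - C := by
      rw [← lt_div_iff₀ (by positivity)]; linarith
    nlinarith [le_abs_self B]
  · intro h
    apply le_antisymm
    · apply sSup_le
      rintro _ ⟨K, hK, rfl⟩
      exact EReal.coe_le_coe_iff.mpr (h.2 hK)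
    · exact le_sSup ⟨k, h.1, rfl⟩

/-- The signature group `Σ`, generated by the values of `σ` on the oriented edges. -/
def signatureGroup : Subgroup (Matrix.unitaryGroup (Fin d) 𝕜) :=
  Subgroup.closure {s | ∃ x y, G.w x y ≠ 0 ∧ G.σ x y = s}

/-- The product `σ_{x₀x₁} σ_{x₁x₂} ⋯` along a walk in a graph `H` on `V`. -/
def signature {H : SimpleGraph V} {u v : V} (c : H.Walk u v) : Matrix.unitaryGroup (Fin d) 𝕜 :=
  (c.darts.map (fun e => G.σ e.fst e.snd)).prod

/-- The local connection structure `B_2^{inc}(x)` is balanced: every cycle in it has trivial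
signature.  (The conjugacy class of the product is that of `1` iff the product is `1`.) -/
def LocallyBalanced (x : V) : Prop :=
  ∀ (u : V) (c : (G.incBall x).Walk u u), c.IsCycle → G.signature c = 1

open Classical in
/-- The Cartesian product `(G,σ) ×_{α,β} (G',σ')`: `σ^×_{(x,x')(y,x')} = σ_{xy}` and
`σ^×_{(x,x')(x,y')} = σ'_{x'y'}` on the edges of the product graph. -/
noncomputable def cart {V' : Type*} (G' : ConnectionGraph 𝕜 d V') (α β : ℝ) (hα : 0 < α)
    (hβ : 0 < β) : ConnectionGraph 𝕜 d (V × V') where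
  toWeightedGraph := G.toWeightedGraph.cart G'.toWeightedGraph α β hα hβ
  σ a b := if a.2 = b.2 then G.σ a.1 b.1 else G'.σ a.2 b.2
  σ_inv := by
    rintro ⟨a, a'⟩ ⟨b, b'⟩ h
    dsimp only [WeightedGraph.cart] at h ⊢
    by_cases h2 : a' = b'
    · subst h2
      rw [if_pos rfl, if_pos rfl]
      apply G.σ_inv
      intro hw
      apply h
      simp [hw, G'.w_self]
    · rw [if_neg h2, if_neg (Ne.symm h2)]
      apply G'.σ_inv
      intro hw
      apply h
      simp [hw, h2]

end ConnectionGraph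

/-! Unitarity turns `Γ` into a weighted sum of products of the connection differences `σ_{xy} f(y) -
f(x)` (`Γ_eq`). On the product, `Γ` is the weighted sum of those of the two factors. In `Γ₂` there
is also a mixed part. Commutation makes the two orders of mixed second differences agree, so its
cross terms cancel and only `αβ/2` times a weighted sum of squared mixed differences remains
(`cart_Γ₂`).

Lower bound: this remainder is nonnegative and is dropped. Cauchy–Schwarz splits the `1/(N+N')` term
between the factors (`cart_CD`).

Upper bound for infinite dimension: functions `f`, `g` with `f x = g x'` glue to a function with
vanishing mixed differences at the base point (`exists_glue`), so the product inequality becomes a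
sum of the two factor inequalities. To separate them, the coupling `f x = g x'` must be removed. If
one factor is balanced, every vector at its base point extends to a section with zero differences
along all edges meeting the unit ball (`LocallyBalanced.exists_parallel`). Adding it changes neither
`Γ` nor `Γ₂` but adjusts the base value freely. -/

namespace ConnectionGraph

open scoped Matrix

/-- The unitary action on `𝕜^d` preserves the Hermitian product. -/
theorem unitary_mulVec_dotProduct {𝕜 : Type*} [RCLike 𝕜] {d : ℕ}
    (s : Matrix.unitaryGroup (Fin d) 𝕜) (u v : Fin d → 𝕜) :
    ((s : Matrix (Fin d) (Fin d) 𝕜) *ᵥ u) ⬝ᵥ star ((s : Matrix (Fin d) (Fin d) 𝕜) *ᵥ v) =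
      u ⬝ᵥ star v := by
  rw [Matrix.star_mulVec, dotProduct_comm, ← Matrix.dotProduct_mulVec, Matrix.mulVec_mulVec,
    ← Matrix.star_eq_conjTranspose, Matrix.UnitaryGroup.star_mul_self, Matrix.one_mulVec,
    dotProduct_comm]

theorem re_dotProduct_star_self {𝕜 : Type*} [RCLike 𝕜] {d : ℕ} (u : Fin d → 𝕜) :
    RCLike.re (u ⬝ᵥ star u) = ∑ i, ‖u i‖ ^ 2 := by
  simp only [dotProduct, Pi.star_apply, RCLike.star_def, RCLike.mul_conj, map_sum]
  exact Finset.sum_congr rfl fun i _ => by norm_cast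

/-! ### Connection differences and the forms `Γ`, `Γ₂` -/

section Basic

variable {𝕜 : Type*} [RCLike 𝕜] {d : ℕ} {V : Type*} (G : ConnectionGraph 𝕜 d V)

/-- The connection difference `σ_{xy} f(y) - f(x)`. -/
def diff (f : V → Fin d → 𝕜) (x y : V) : Fin d → 𝕜 :=
  (G.σ x y : Matrix (Fin d) (Fin d) 𝕜) *ᵥ f y - f x

theorem mem_nbr {x y : V} : y ∈ G.nbr x ↔ G.w x y ≠ 0 := by
  simp [WeightedGraph.nbr]

theorem ne_of_mem_nbr {x y : V} (h : y ∈ G.nbr x) : y ≠ x := by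
  rintro rfl
  exact G.mem_nbr.1 h (G.w_self y)

theorem mem_nbr_symm {x y : V} (h : y ∈ G.nbr x) : x ∈ G.nbr y := by
  rw [mem_nbr] at h ⊢
  rwa [G.w_symm]

theorem p_nonneg (x y : V) : 0 ≤ G.p x y :=
  div_nonneg (G.w_nonneg x y) (G.μ_pos x).le

theorem σ_mulVec_σ_mulVec {x y : V} (h : y ∈ G.nbr x) (v : Fin d → 𝕜) :
    (G.σ x y : Matrix (Fin d) (Fin d) 𝕜) *ᵥ ((G.σ y x : Matrix (Fin d) (Fin d) 𝕜) *ᵥ v) = v := by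
  have h1 : G.σ x y * G.σ y x = 1 := by
    rw [G.σ_inv x y (G.mem_nbr.1 h), inv_mul_cancel]
  rw [Matrix.mulVec_mulVec, ← Matrix.UnitaryGroup.mul_val, h1, Matrix.UnitaryGroup.one_val,
    Matrix.one_mulVec]

theorem clap_eq (f : V → Fin d → 𝕜) (x : V) :
    G.clap f x = ∑ y ∈ G.nbr x, (G.p x y : 𝕜) • G.diff f x y := rfl

/-- Since `σ_{xy}` is unitary, the product of `f y` and `g y` may be replaced by that of their
transports to `x`; each summand then factors. -/
theorem Γ_eq (f g : V → Fin d → 𝕜) (x : V) :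
    G.Γ f g x = (∑ y ∈ G.nbr x, (G.p x y : 𝕜) * (G.diff f x y ⬝ᵥ star (G.diff g x y))) / 2 := by
  rw [Γ, clap_eq, clap_eq, WeightedGraph.lap, star_sum, dotProduct_sum, sum_dotProduct,
    ← Finset.sum_sub_distrib, ← Finset.sum_sub_distrib]
  congr 1
  refine Finset.sum_congr rfl fun y _ => ?_
  have h := unitary_mulVec_dotProduct (G.σ x y) (f y) (g y)
  simp only [diff, star_smul, RCLike.star_def, RCLike.conj_ofReal, dotProduct_smul, smul_dotProduct,
    smul_eq_mul, star_sub, sub_dotProduct, dotProduct_sub] at h ⊢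
  rw [h]
  ring

theorem re_Γ_nonneg (f : V → Fin d → 𝕜) (x : V) : 0 ≤ RCLike.re (G.Γ f f x) := by
  have h : G.Γ f f x = (((∑ y ∈ G.nbr x, G.p x y * ∑ i, ‖G.diff f x y i‖ ^ 2) / 2 : ℝ) : 𝕜) := by
    rw [Γ_eq]
    push_cast
    congr 1
    refine Finset.sum_congr rfl fun y _ => ?_
    congr 1
    simp [dotProduct, RCLike.mul_conj]
  rw [h, RCLike.ofReal_re]
  exact div_nonneg (Finset.sum_nonneg fun y _ => mul_nonneg (G.p_nonneg x y)
    (Finset.sum_nonneg fun i _ => sq_nonneg _)) zero_le_two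

theorem diff_add (f g : V → Fin d → 𝕜) (x y : V) :
    G.diff (f + g) x y = G.diff f x y + G.diff g x y := by
  simp only [diff, Pi.add_apply, Matrix.mulVec_add]
  abel

theorem diff_smul (c : 𝕜) (f : V → Fin d → 𝕜) (x y : V) :
    G.diff (c • f) x y = c • G.diff f x y := by
  simp only [diff, Pi.smul_apply, Matrix.mulVec_smul, smul_sub]

theorem Γ_add_right (f g h : V → Fin d → 𝕜) (x : V) :
    G.Γ f (g + h) x = G.Γ f g x + G.Γ f h x := by
  simp only [Γ_eq, diff_add, star_add, dotProduct_add, mul_add, Finset.sum_add_distrib, add_div]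

theorem Γ_add_left (f g h : V → Fin d → 𝕜) (x : V) :
    G.Γ (f + g) h x = G.Γ f h x + G.Γ g h x := by
  simp only [Γ_eq, diff_add, add_dotProduct, mul_add, Finset.sum_add_distrib, add_div]

theorem Γ_ofReal_smul_right (r : ℝ) (f g : V → Fin d → 𝕜) (x : V) :
    G.Γ f ((r : 𝕜) • g) x = r * G.Γ f g x := by
  simp only [Γ_eq, diff_smul, star_smul, RCLike.star_def, RCLike.conj_ofReal, dotProduct_smul,
    smul_eq_mul, mul_left_comm _ (r : 𝕜), ← Finset.mul_sum, mul_div_assoc]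

theorem Γ_ofReal_smul_left (r : ℝ) (f g : V → Fin d → 𝕜) (x : V) :
    G.Γ ((r : 𝕜) • f) g x = r * G.Γ f g x := by
  simp only [Γ_eq, diff_smul, smul_dotProduct,
    smul_eq_mul, mul_left_comm _ (r : 𝕜), ← Finset.mul_sum, mul_div_assoc]

theorem clap_congr {f g : V → Fin d → 𝕜} {x : V}
    (h : ∀ y ∈ G.nbr x, G.diff f x y = G.diff g x y) : G.clap f x = G.clap g x := by
  rw [clap_eq, clap_eq]
  exact Finset.sum_congr rfl fun y hy => by rw [h y hy]

theorem Γ_congr {f g f' g' : V → Fin d → 𝕜} {x : V}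
    (h : ∀ y ∈ G.nbr x, G.diff f x y = G.diff f' x y)
    (h' : ∀ y ∈ G.nbr x, G.diff g x y = G.diff g' x y) : G.Γ f g x = G.Γ f' g' x := by
  rw [Γ_eq, Γ_eq]
  congr 1
  exact Finset.sum_congr rfl fun y hy => by rw [h y hy, h' y hy]

/-- `Γ_2^σ(f,f)(x)` only depends on the connection differences of `f` along the edges with an end
in `B_1(x)`. -/
theorem Γ₂_congr {f g : V → Fin d → 𝕜} {x : V}
    (h : ∀ y ∈ G.nbr x, G.diff f x y = G.diff g x y)
    (h' : ∀ y ∈ G.nbr x, ∀ z ∈ G.nbr y, G.diff f y z = G.diff g y z) :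
    G.Γ₂ f f x = G.Γ₂ g g x := by
  have hc : ∀ y ∈ G.nbr x, G.diff (G.clap f) x y = G.diff (G.clap g) x y := fun y hy => by
    rw [diff, diff, G.clap_congr h, G.clap_congr (h' y hy)]
  rw [Γ₂, Γ₂, G.Γ_congr h hc, G.Γ_congr hc h]
  congr 3
  refine Finset.sum_congr rfl fun y hy => ?_
  rw [G.Γ_congr h h, G.Γ_congr (h' y hy) (h' y hy)]

theorem diff_zero (x y : V) : G.diff 0 x y = 0 := by
  simp [diff]

theorem Γ_zero_left (g : V → Fin d → 𝕜) (x : V) : G.Γ 0 g x = 0 := by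
  simp [Γ_eq, diff_zero]

theorem Γ₂_zero (x : V) : G.Γ₂ 0 0 x = 0 := by
  have h : G.clap 0 = 0 := by
    ext y : 1
    simp [clap_eq, diff_zero]
  simp [Γ₂, h, Γ_zero_left, WeightedGraph.lap]

/-! ### Balanced incomplete balls and parallel sections -/

theorem edist_le_one {x y : V} (h : y ∈ G.nbr x) : G.graph.edist x y ≤ 1 :=
  (SimpleGraph.edist_le_one_iff_adj_or_eq).2 (Or.inl (G.mem_nbr.1 h))

/-- An edge with an end in the unit ball never joins two vertices at distance 2, so it is not
removed. -/
theorem incBall_adj {x y z : V} (h : y = x ∨ y ∈ G.nbr x) (hz : z ∈ G.nbr y) :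
    (G.incBall x).Adj y z := by
  have h1 : G.graph.edist x y ≤ 1 := by
    rcases h with rfl | h
    · simp
    · exact G.edist_le_one h
  refine ⟨G.mem_nbr.1 hz, h1.trans (by norm_num), ?_, fun h2 => ?_⟩
  · calc G.graph.edist x z ≤ G.graph.edist x y + G.graph.edist y z :=
          SimpleGraph.edist_triangle
      _ ≤ 1 + 1 := add_le_add h1 (G.edist_le_one hz)
      _ = 2 := by norm_num
  · rw [h2.1] at h1
    exact absurd h1 (by norm_num)

theorem LocallyBalanced.triangle {x y z : V} (hb : G.LocallyBalanced x) (hy : y ∈ G.nbr x)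
    (hz : z ∈ G.nbr y) (hx : x ∈ G.nbr z) : G.σ x y * (G.σ y z * G.σ z x) = 1 := by
  have a1 := G.incBall_adj (Or.inl rfl) hy
  have a2 := G.incBall_adj (Or.inr hy) hz
  have a3 := G.incBall_adj (Or.inr (G.mem_nbr_symm hx)) hx
  have h := hb x (.cons a1 (.cons a2 (.cons a3 .nil))) (by
    have := a1.ne; have := a2.ne; have := a3.ne
    have := a1.ne'; have := a2.ne'; have := a3.ne'
    simp [SimpleGraph.Walk.cons_isCycle_iff, SimpleGraph.Walk.cons_isPath_iff, *])
  simpa [signature] using h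

theorem LocallyBalanced.square {x y z t : V} (hb : G.LocallyBalanced x) (hy : y ∈ G.nbr x)
    (hz : z ∈ G.nbr y) (ht : t ∈ G.nbr z) (hx : x ∈ G.nbr t) (hxz : z ≠ x) (hyt : t ≠ y) :
    G.σ x y * (G.σ y z * (G.σ z t * G.σ t x)) = 1 := by
  have a1 := G.incBall_adj (Or.inl rfl) hy
  have a2 := G.incBall_adj (Or.inr hy) hz
  have a3 := (G.incBall_adj (Or.inr (G.mem_nbr_symm hx)) (G.mem_nbr_symm ht)).symm
  have a4 := G.incBall_adj (Or.inr (G.mem_nbr_symm hx)) hx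
  have h := hb x (.cons a1 (.cons a2 (.cons a3 (.cons a4 .nil)))) (by
    have := a1.ne; have := a2.ne; have := a3.ne; have := a4.ne
    have := a1.ne'; have := a2.ne'; have := a3.ne'; have := a4.ne'
    simp [SimpleGraph.Walk.cons_isCycle_iff, SimpleGraph.Walk.cons_isPath_iff, hyt.symm, hxz.symm, *])
  simpa [signature] using h

open Classical in
/-- If `B_2^{inc}(x)` is balanced, every vector at `x` extends to a parallel section. -/
theorem LocallyBalanced.exists_parallel {x : V} (hb : G.LocallyBalanced x) (v : Fin d → 𝕜) :
    ∃ h : V → Fin d → 𝕜, h x = v ∧ (∀ y ∈ G.nbr x, G.diff h x y = 0) ∧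
      ∀ y ∈ G.nbr x, ∀ z ∈ G.nbr y, G.diff h y z = 0 := by
  -- Transport of `v` along a path of length at most 2; on the 2-sphere the middle vertex is an
  -- arbitrary choice, harmless by the square identity.
  let h : V → Fin d → 𝕜 := fun u =>
    if u = x then v
    else if u ∈ G.nbr x then (G.σ u x : Matrix (Fin d) (Fin d) 𝕜) *ᵥ v
    else if hu : ∃ y ∈ G.nbr x, u ∈ G.nbr y then
      (G.σ u hu.choose : Matrix (Fin d) (Fin d) 𝕜) *ᵥ
        ((G.σ hu.choose x : Matrix (Fin d) (Fin d) 𝕜) *ᵥ v)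
    else 0
  have hx : h x = v := if_pos rfl
  have hn : ∀ y ∈ G.nbr x, h y = (G.σ y x : Matrix (Fin d) (Fin d) 𝕜) *ᵥ v := fun y hy => by
    simp only [h, if_neg (G.ne_of_mem_nbr hy), if_pos hy]
  refine ⟨h, hx, fun y hy => ?_, fun y hy z hz => ?_⟩
  · rw [diff, hx, hn y hy, G.σ_mulVec_σ_mulVec hy, sub_self]
  · rw [diff, hn y hy, sub_eq_zero]
    by_cases hzx : z = x
    · rw [hzx, hx]
    by_cases hz1 : z ∈ G.nbr x
    · have ht := LocallyBalanced.triangle G hb hy hz (G.mem_nbr_symm hz1)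
      rw [hn z hz1, Matrix.mulVec_mulVec, ← Matrix.UnitaryGroup.mul_val,
        eq_inv_of_mul_eq_one_right ht, ← G.σ_inv y x (G.mem_nbr.1 (G.mem_nbr_symm hy))]
    · have hu : ∃ y ∈ G.nbr x, z ∈ G.nbr y := ⟨y, hy, hz⟩
      obtain ⟨ht, hzt⟩ := hu.choose_spec
      simp only [h, if_neg hzx, if_neg hz1, dif_pos hu]
      generalize hu.choose = t at ht hzt
      -- If the chosen middle vertex is `y` itself, the square degenerates and is no cycle.
      by_cases hty : t = y
      · subst hty
        rw [G.σ_mulVec_σ_mulVec hz]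
      · have hs := LocallyBalanced.square G hb hy hz (G.mem_nbr_symm hzt) (G.mem_nbr_symm ht)
          hzx hty
        rw [Matrix.mulVec_mulVec, Matrix.mulVec_mulVec, ← Matrix.UnitaryGroup.mul_val,
          ← Matrix.UnitaryGroup.mul_val, mul_assoc, eq_inv_of_mul_eq_one_right hs,
          ← G.σ_inv y x (G.mem_nbr.1 (G.mem_nbr_symm hy))]

end Basic

/-! ### Operators on the Cartesian product -/

section Product

variable {𝕜 : Type*} [RCLike 𝕜] {d : ℕ} {V V' : Type*} (G : ConnectionGraph 𝕜 d V)
  (G' : ConnectionGraph 𝕜 d V') (α β : ℝ) (hα : 0 < α) (hβ : 0 < β)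

theorem cart_p_left {a y : V} {b : V'} (h : y ∈ G.nbr a) :
    (G.cart G' α β hα hβ).p (a, b) (y, b) = α * G.p a y := by
  have h1 := (G.μ_pos a).ne'
  have h2 := (G'.μ_pos b).ne'
  simp only [cart, WeightedGraph.cart, WeightedGraph.p, if_true,
    if_neg (G.ne_of_mem_nbr h).symm, add_zero]
  field_simp

theorem cart_p_right {a : V} {b y : V'} (h : y ∈ G'.nbr b) :
    (G.cart G' α β hα hβ).p (a, b) (a, y) = β * G'.p b y := by
  have h1 := (G.μ_pos a).ne'
  have h2 := (G'.μ_pos b).ne'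
  simp only [cart, WeightedGraph.cart, WeightedGraph.p, if_true,
    if_neg (G'.ne_of_mem_nbr h).symm, zero_add]
  field_simp

theorem cart_σ_left (a y : V) (b : V') :
    (G.cart G' α β hα hβ).σ (a, b) (y, b) = G.σ a y := by
  simp [cart]

theorem cart_σ_right (a : V) {b y : V'} (h : y ∈ G'.nbr b) :
    (G.cart G' α β hα hβ).σ (a, b) (a, y) = G'.σ b y := by
  simp [cart, (G'.ne_of_mem_nbr h).symm]

open Classical in
theorem cart_nbr (a : V) (b : V') :
    (G.cart G' α β hα hβ).nbr (a, b) =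
      (G.nbr a).image (fun y => (y, b)) ∪ (G'.nbr b).image (fun y => (a, y)) := by
  ext ⟨c, e⟩
  have h1 := (G.μ_pos a).ne'
  have h2 := (G'.μ_pos b).ne'
  rw [mem_nbr]
  simp only [mem_nbr, Finset.mem_union, Finset.mem_image, Prod.mk.injEq, cart, WeightedGraph.cart]
  by_cases hc : a = c <;> by_cases he : b = e
  · subst hc he
    simp [G.w_self, G'.w_self]
  · subst hc
    simp [he, hβ.ne', h1]
  · subst he
    simp [hc, hα.ne', h2]
  · simp [hc, he]

/-- Sums over the neighbours in the product split into a horizontal and a vertical part. -/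
theorem cart_sum {M : Type*} [AddCommMonoid M] [Module 𝕜 M] (φ : V × V' → M) (a : V) (b : V') :
    ∑ c ∈ (G.cart G' α β hα hβ).nbr (a, b), ((G.cart G' α β hα hβ).p (a, b) c : 𝕜) • φ c =
      (α : 𝕜) • ∑ y ∈ G.nbr a, (G.p a y : 𝕜) • φ (y, b) +
      (β : 𝕜) • ∑ y ∈ G'.nbr b, (G'.p b y : 𝕜) • φ (a, y) := by
  classical
  rw [cart_nbr, Finset.sum_union, Finset.sum_image, Finset.sum_image, Finset.smul_sum,
    Finset.smul_sum]
  · congr 1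
    · refine Finset.sum_congr rfl fun y hy => ?_
      rw [cart_p_left G G' α β hα hβ hy, RCLike.ofReal_mul, mul_smul]
    · refine Finset.sum_congr rfl fun y hy => ?_
      rw [cart_p_right G G' α β hα hβ hy, RCLike.ofReal_mul, mul_smul]
  · intro y _ z _ h
    exact congrArg Prod.snd h
  · intro y _ z _ h
    exact congrArg Prod.fst h
  · rw [Finset.disjoint_left]
    simp only [Finset.mem_image]
    rintro _ ⟨y, hy, rfl⟩ ⟨z, hz, h⟩
    exact G'.ne_of_mem_nbr hz (congrArg Prod.snd h)

theorem cart_lap (φ : V × V' → 𝕜) (a : V) (b : V') :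
    (G.cart G' α β hα hβ).lap φ (a, b) =
      α * G.lap (fun y => φ (y, b)) a + β * G'.lap (fun y => φ (a, y)) b :=
  cart_sum G G' α β hα hβ (fun c => φ c - φ (a, b)) a b

theorem cart_clap (F : V × V' → Fin d → 𝕜) (a : V) (b : V') :
    (G.cart G' α β hα hβ).clap F (a, b) =
      (α : 𝕜) • G.clap (fun y => F (y, b)) a + (β : 𝕜) • G'.clap (fun y => F (a, y)) b := by
  refine (cart_sum G G' α β hα hβ (fun c => (G.cart G' α β hα hβ).diff F (a, b) c) a b).trans ?_
  simp only [clap_eq]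
  congr 2
  · refine Finset.sum_congr rfl fun y _ => ?_
    simp only [diff, cart_σ_left]
  · refine Finset.sum_congr rfl fun y hy => ?_
    simp only [diff, cart_σ_right G G' α β hα hβ a hy]

theorem cart_Γ (F H : V × V' → Fin d → 𝕜) (a : V) (b : V') :
    (G.cart G' α β hα hβ).Γ F H (a, b) =
      α * G.Γ (fun y => F (y, b)) (fun y => H (y, b)) a +
      β * G'.Γ (fun y => F (a, y)) (fun y => H (a, y)) b := by
  simp only [Γ, cart_clap, cart_lap, star_add, star_smul, RCLike.star_def, RCLike.conj_ofReal,
    dotProduct_add, add_dotProduct, dotProduct_smul, smul_dotProduct, smul_eq_mul]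
  ring

/-- The mixed second difference at `(x,x')` along the edges `x ∼ y` and `x' ∼ y'`. -/
def mixedDiff (F : V × V' → Fin d → 𝕜) (x y : V) (x' y' : V') : Fin d → 𝕜 :=
  G.diff (fun a => G'.diff (fun b => F (a, b)) x' y') x y

/-- The two orders differ only in the product of connection matrices applied to `F (y, y')`. -/
theorem mixedDiff_comm (F : V × V' → Fin d → 𝕜) {x y : V} {x' y' : V'}
    (h : G.σ x y * G'.σ x' y' = G'.σ x' y' * G.σ x y) :
    G.mixedDiff G' F x y x' y' =
      G'.mixedDiff G (fun c => F (c.2, c.1)) x' y' x y := by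
  have h' : (G.σ x y : Matrix (Fin d) (Fin d) 𝕜) * (G'.σ x' y' : Matrix (Fin d) (Fin d) 𝕜) =
      (G'.σ x' y' : Matrix (Fin d) (Fin d) 𝕜) * (G.σ x y : Matrix (Fin d) (Fin d) 𝕜) := by
    rw [← Matrix.UnitaryGroup.mul_val, h, Matrix.UnitaryGroup.mul_val]
  simp only [mixedDiff, diff, Matrix.mulVec_sub, Matrix.mulVec_mulVec, h']
  abel

theorem diff_clap (F : V × V' → Fin d → 𝕜) (x y : V) (x' : V') :
    G.diff (fun a => G'.clap (fun b => F (a, b)) x') x y =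
      ∑ y' ∈ G'.nbr x', (G'.p x' y' : 𝕜) • G.mixedDiff G' F x y x' y' := by
  rw [diff, clap_eq, clap_eq, Matrix.mulVec_sum, ← Finset.sum_sub_distrib]
  refine Finset.sum_congr rfl fun y' _ => ?_
  rw [Matrix.mulVec_smul, ← smul_sub]
  rfl

/-- The part of the mixed term of `2 Γ_2` in which the horizontal operator acts last. -/
theorem mixed_term (F : V × V' → Fin d → 𝕜) (x : V) (x' : V') :
    G.lap (fun a => G'.Γ (fun b => F (a, b)) (fun b => F (a, b)) x') x
      - G.Γ (fun a => F (a, x')) (fun a => G'.clap (fun b => F (a, b)) x') x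
      - G.Γ (fun a => G'.clap (fun b => F (a, b)) x') (fun a => F (a, x')) x =
    (∑ y ∈ G.nbr x, ∑ y' ∈ G'.nbr x', (G.p x y : 𝕜) * (G'.p x' y' : 𝕜) *
      (G.mixedDiff G' F x y x' y' ⬝ᵥ star (G.mixedDiff G' F x y x' y') +
      (G'.diff (fun b => F (x, b)) x' y' ⬝ᵥ star (G.mixedDiff G' F x y x' y') +
        G.mixedDiff G' F x y x' y' ⬝ᵥ star (G'.diff (fun b => F (x, b)) x' y')) -
      (G.diff (fun a => F (a, x')) x y ⬝ᵥ star (G.mixedDiff G' F x y x' y') +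
        G.mixedDiff G' F x y x' y' ⬝ᵥ star (G.diff (fun a => F (a, x')) x y)))) / 2 := by
  simp only [Γ_eq, WeightedGraph.lap, diff_clap, ← sub_div, Finset.sum_div, ← Finset.sum_sub_distrib,
    star_sum, dotProduct_sum, sum_dotProduct, Finset.mul_sum]
  refine Finset.sum_congr rfl fun y _ => Finset.sum_congr rfl fun y' _ => ?_
  have h := unitary_mulVec_dotProduct (G.σ x y) (G'.diff (fun b => F (y, b)) x' y')
    (G'.diff (fun b => F (y, b)) x' y')
  have h' : (G.σ x y : Matrix (Fin d) (Fin d) 𝕜) *ᵥ G'.diff (fun b => F (y, b)) x' y' =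
      G.mixedDiff G' F x y x' y' + G'.diff (fun b => F (x, b)) x' y' :=
    (sub_add_cancel _ _).symm
  rw [← h, h']
  simp only [star_smul, RCLike.star_def, RCLike.conj_ofReal, dotProduct_smul, smul_dotProduct,
    smul_eq_mul, star_add, add_dotProduct, dotProduct_add]
  ring

/-- The product formula for `Γ_2`. -/
theorem cart_Γ₂ (F : V × V' → Fin d → 𝕜) {x : V} {x' : V'}
    (hσ : ∀ y ∈ G.nbr x, ∀ y' ∈ G'.nbr x', G.σ x y * G'.σ x' y' = G'.σ x' y' * G.σ x y) :
    (G.cart G' α β hα hβ).Γ₂ F F (x, x') =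
      α ^ 2 * G.Γ₂ (fun a => F (a, x')) (fun a => F (a, x')) x +
      β ^ 2 * G'.Γ₂ (fun b => F (x, b)) (fun b => F (x, b)) x' +
      α * β / 2 * ∑ y ∈ G.nbr x, ∑ y' ∈ G'.nbr x', (G.p x y : 𝕜) * (G'.p x' y' : 𝕜) *
        (G.mixedDiff G' F x y x' y' ⬝ᵥ star (G.mixedDiff G' F x y x' y')) := by
  have h1 := mixed_term G G' F x x'
  have h2 := mixed_term G' G (fun c => F (c.2, c.1)) x' x
  dsimp only at h2
  rw [Finset.sum_comm] at h2
  have h3 : (fun a => (G.cart G' α β hα hβ).clap F (a, x')) =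
      (α : 𝕜) • G.clap (fun y => F (y, x')) +
        (β : 𝕜) • fun a => G'.clap (fun y => F (a, y)) x' := by
    ext a : 1
    rw [cart_clap]; rfl
  have h4 : (fun b => (G.cart G' α β hα hβ).clap F (x, b)) =
      (β : 𝕜) • G'.clap (fun y => F (x, y)) +
        (α : 𝕜) • fun b => G.clap (fun y => F (y, b)) x := by
    ext b : 1
    rw [cart_clap, add_comm]; rfl
  have hl : ∀ (φ ψ : V → 𝕜), G.lap (fun a => (α : 𝕜) * φ a + (β : 𝕜) * ψ a) x =
      α * G.lap φ x + β * G.lap ψ x := fun φ ψ => by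
    simp only [WeightedGraph.lap, Finset.mul_sum, ← Finset.sum_add_distrib]
    exact Finset.sum_congr rfl fun y _ => by ring
  have hl' : ∀ (φ ψ : V' → 𝕜), G'.lap (fun a => (α : 𝕜) * φ a + (β : 𝕜) * ψ a) x' =
      α * G'.lap φ x' + β * G'.lap ψ x' := fun φ ψ => by
    simp only [WeightedGraph.lap, Finset.mul_sum, ← Finset.sum_add_distrib]
    exact Finset.sum_congr rfl fun y _ => by ring
  -- The cross terms appear in `h1` and `h2` with opposite signs once the mixed differences are
  -- identified; the two halves of the squared term add up.
  have hmix := (congrArg₂ (· + ·) h1 h2).trans (b := _ / 2 + _ / 2)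
    (c := ∑ y ∈ G.nbr x, ∑ y' ∈ G'.nbr x', (G.p x y : 𝕜) * (G'.p x' y' : 𝕜) *
      (G.mixedDiff G' F x y x' y' ⬝ᵥ star (G.mixedDiff G' F x y x' y'))) (by
    rw [← add_div, ← Finset.sum_add_distrib, div_eq_iff (two_ne_zero' 𝕜), Finset.sum_mul]
    refine Finset.sum_congr rfl fun y hy => ?_
    rw [← Finset.sum_add_distrib, Finset.sum_mul]
    refine Finset.sum_congr rfl fun y' hy' => ?_
    rw [← mixedDiff_comm G G' F (hσ y hy y' hy')]
    ring)
  simp only [Γ₂, cart_lap, cart_Γ, h3, h4, hl, hl', Γ_add_left, Γ_add_right, Γ_ofReal_smul_left,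
    Γ_ofReal_smul_right]
  rw [← hmix]
  ring

theorem cart_re_Γ (F : V × V' → Fin d → 𝕜) (a : V) (b : V') :
    RCLike.re ((G.cart G' α β hα hβ).Γ F F (a, b)) =
      α * RCLike.re (G.Γ (fun y => F (y, b)) (fun y => F (y, b)) a) +
      β * RCLike.re (G'.Γ (fun y => F (a, y)) (fun y => F (a, y)) b) := by
  rw [cart_Γ, map_add, RCLike.re_ofReal_mul, RCLike.re_ofReal_mul]

theorem cart_re_Γ₂ (F : V × V' → Fin d → 𝕜) {x : V} {x' : V'}
    (hσ : ∀ y ∈ G.nbr x, ∀ y' ∈ G'.nbr x', G.σ x y * G'.σ x' y' = G'.σ x' y' * G.σ x y) :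
    RCLike.re ((G.cart G' α β hα hβ).Γ₂ F F (x, x')) =
      α ^ 2 * RCLike.re (G.Γ₂ (fun a => F (a, x')) (fun a => F (a, x')) x) +
      β ^ 2 * RCLike.re (G'.Γ₂ (fun b => F (x, b)) (fun b => F (x, b)) x') +
      α * β / 2 * ∑ y ∈ G.nbr x, ∑ y' ∈ G'.nbr x', G.p x y * G'.p x' y' *
        ∑ i, ‖G.mixedDiff G' F x y x' y' i‖ ^ 2 := by
  have e : ((α : 𝕜) * β / 2) = ((α * β / 2 : ℝ) : 𝕜) := by push_cast; rfl
  rw [cart_Γ₂ G G' α β hα hβ F hσ, e, ← RCLike.ofReal_pow, ← RCLike.ofReal_pow, map_add, map_add,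
    RCLike.re_ofReal_mul, RCLike.re_ofReal_mul, RCLike.re_ofReal_mul]
  simp only [map_sum, ← RCLike.ofReal_mul, RCLike.re_ofReal_mul, re_dotProduct_star_self]

/-! ### Lower curvature bound -/

theorem inv_add_toReal_mul_sq_le {N N' : ENNReal} (hN : 0 < N) (hN' : 0 < N') (a b : ℝ) :
    ((N + N')⁻¹).toReal * (a + b) ^ 2 ≤ (N⁻¹).toReal * a ^ 2 + (N'⁻¹).toReal * b ^ 2 := by
  have h0 : 0 ≤ (N⁻¹).toReal * a ^ 2 + (N'⁻¹).toReal * b ^ 2 := by positivity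
  -- If either dimension is infinite, the left side vanishes.
  by_cases h : N = ⊤
  · simpa [h] using h0
  by_cases h' : N' = ⊤
  · simpa [h'] using h0
  have hp := ENNReal.toReal_pos hN.ne' h
  have hp' := ENNReal.toReal_pos hN'.ne' h'
  simp only [ENNReal.toReal_inv, ENNReal.toReal_add h h']
  rw [inv_mul_eq_div, inv_mul_eq_div, inv_mul_eq_div, div_add_div _ _ hp.ne' hp'.ne',
    div_le_div_iff₀ (by positivity) (by positivity)]
  have := mul_pos hp hp'
  nlinarith [sq_nonneg (N'.toReal * a - N.toReal * b)]

theorem cart_CD {x : V} {x' : V'}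
    (hσ : ∀ y ∈ G.nbr x, ∀ y' ∈ G'.nbr x', G.σ x y * G'.σ x' y' = G'.σ x' y' * G.σ x y)
    {N N' : ENNReal} (hN : 0 < N) (hN' : 0 < N') {K K' L : ℝ} (hK : G.CD x K N)
    (hK' : G'.CD x' K' N') (hL : L ≤ α * K) (hL' : L ≤ β * K') :
    (G.cart G' α β hα hβ).CD (x, x') L (N + N') := by
  intro F
  have h := mul_le_mul_of_nonneg_left (hK fun a => F (a, x')) (sq_nonneg α)
  have h' := mul_le_mul_of_nonneg_left (hK' fun b => F (x, b)) (sq_nonneg β)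
  rw [cart_re_Γ₂ G G' α β hα hβ F hσ, cart_re_Γ, cart_clap]
  -- Nonnegativity of `Γ` allows lowering both constants to the common `L`.
  have hg := mul_le_mul_of_nonneg_right hL
    (mul_nonneg hα.le (G.re_Γ_nonneg (fun a => F (a, x')) x))
  have hg' := mul_le_mul_of_nonneg_right hL'
    (mul_nonneg hβ.le (G'.re_Γ_nonneg (fun b => F (x, b)) x'))
  have hm : 0 ≤ α * β / 2 * ∑ y ∈ G.nbr x, ∑ y' ∈ G'.nbr x', G.p x y * G'.p x' y' *
      ∑ i, ‖G.mixedDiff G' F x y x' y' i‖ ^ 2 :=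
    mul_nonneg (by positivity) (Finset.sum_nonneg fun y _ => Finset.sum_nonneg fun y' _ =>
      mul_nonneg (mul_nonneg (G.p_nonneg _ _) (G'.p_nonneg _ _))
        (Finset.sum_nonneg fun i _ => sq_nonneg _))
  have hc : ((N + N')⁻¹).toReal * (∑ i, ‖((α : 𝕜) • G.clap (fun y => F (y, x')) x +
      (β : 𝕜) • G'.clap (fun y => F (x, y)) x') i‖ ^ 2) ≤
      α ^ 2 * ((N⁻¹).toReal * ∑ i, ‖G.clap (fun y => F (y, x')) x i‖ ^ 2) +
      β ^ 2 * ((N'⁻¹).toReal * ∑ i, ‖G'.clap (fun y => F (x, y)) x' i‖ ^ 2) := by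
    simp only [Finset.mul_sum, ← Finset.sum_add_distrib]
    refine Finset.sum_le_sum fun i _ => ?_
    have hn := norm_add_le ((α : 𝕜) * G.clap (fun y => F (y, x')) x i)
      ((β : 𝕜) * G'.clap (fun y => F (x, y)) x' i)
    rw [norm_mul, norm_mul, RCLike.norm_of_nonneg hα.le, RCLike.norm_of_nonneg hβ.le] at hn
    refine (mul_le_mul_of_nonneg_left (pow_le_pow_left₀ (norm_nonneg _) hn 2)
      ENNReal.toReal_nonneg).trans ((inv_add_toReal_mul_sq_le hN hN' _ _).trans (le_of_eq ?_))
    ring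
  linarith

/-! ### Gluing and the upper bound -/

open Classical in
/-- Functions on the factors agreeing at the base point glue to a function on the product whose
mixed second differences at the base point vanish. -/
theorem exists_glue {x : V} {x' : V'} (f : V → Fin d → 𝕜) (g : V' → Fin d → 𝕜)
    (hfg : f x = g x') :
    ∃ F : V × V' → Fin d → 𝕜, (fun a => F (a, x')) = f ∧ (fun b => F (x, b)) = g ∧
      ∀ y ∈ G.nbr x, ∀ y' ∈ G'.nbr x', G.mixedDiff G' F x y x' y' = 0 := by
  -- The off-axis value solves the equation `mixedDiff = 0` for `F (y, y')`, by inverting both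
  -- connection matrices.
  refine ⟨fun c => if c.2 = x' then f c.1 else if c.1 = x then g c.2 else
    ((G'.σ x' c.2)⁻¹ : Matrix.unitaryGroup (Fin d) 𝕜).1 *ᵥ
      (((G.σ x c.1)⁻¹ : Matrix.unitaryGroup (Fin d) 𝕜).1 *ᵥ ((G.σ x c.1).1 *ᵥ f c.1 +
        ((G'.σ x' c.2).1 *ᵥ g c.2 - f x))), ?_, ?_, ?_⟩
  · ext a : 1
    simp
  · ext b : 1
    by_cases hb : b = x'
    · simp [hb, hfg]
    · simp [hb]
  · intro y hy y' hy'
    have h1 : ∀ (s : Matrix.unitaryGroup (Fin d) 𝕜) (u : Fin d → 𝕜), s.1 *ᵥ ((s⁻¹).1 *ᵥ u) = u :=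
      fun s u => by
        rw [Matrix.mulVec_mulVec, ← Matrix.UnitaryGroup.mul_val, mul_inv_cancel,
          Matrix.UnitaryGroup.one_val, Matrix.one_mulVec]
    simp only [mixedDiff, diff, if_true, if_neg (G.ne_of_mem_nbr hy),
      if_neg (G'.ne_of_mem_nbr hy'), h1, Matrix.mulVec_sub]
    abel

theorem add_nonneg_of_cart_CD {x : V} {x' : V'}
    (hσ : ∀ y ∈ G.nbr x, ∀ y' ∈ G'.nbr x', G.σ x y * G'.σ x' y' = G'.σ x' y' * G.σ x y)
    {K : ℝ} (hK : (G.cart G' α β hα hβ).CD (x, x') K ⊤) (f : V → Fin d → 𝕜)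
    (g : V' → Fin d → 𝕜) (hfg : f x = g x') :
    K * (α * RCLike.re (G.Γ f f x) + β * RCLike.re (G'.Γ g g x')) ≤
      α ^ 2 * RCLike.re (G.Γ₂ f f x) + β ^ 2 * RCLike.re (G'.Γ₂ g g x') := by
  obtain ⟨F, hf, hg, hF⟩ := exists_glue G G' f g hfg
  have h := hK F
  rw [cart_re_Γ₂ G G' α β hα hβ F hσ, cart_re_Γ, hf, hg, Finset.sum_eq_zero fun y hy =>
    Finset.sum_eq_zero fun y' hy' => by rw [hF y hy y' hy']; simp] at h
  simpa using h

/-- If a sum of two curvature forms is nonnegative on pairs agreeing at the base point and one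
factor is balanced, then both forms are nonnegative. -/
theorem LocallyBalanced.le_of_add {x : V} {x' : V'} (hb : G.LocallyBalanced x) {K α β : ℝ}
    (h : ∀ (f : V → Fin d → 𝕜) (g : V' → Fin d → 𝕜), f x = g x' →
      K * (α * RCLike.re (G.Γ f f x) + β * RCLike.re (G'.Γ g g x')) ≤
        α ^ 2 * RCLike.re (G.Γ₂ f f x) + β ^ 2 * RCLike.re (G'.Γ₂ g g x')) :
    (∀ f, K * (α * RCLike.re (G.Γ f f x)) ≤ α ^ 2 * RCLike.re (G.Γ₂ f f x)) ∧
      ∀ g, K * (β * RCLike.re (G'.Γ g g x')) ≤ β ^ 2 * RCLike.re (G'.Γ₂ g g x') := by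
  constructor
  · intro f
    -- With this value `f + k` vanishes at `x` and can be paired with zero.
    obtain ⟨k, hk, hk1, hk2⟩ := LocallyBalanced.exists_parallel G hb (-f x)
    have h1 : ∀ y ∈ G.nbr x, G.diff (f + k) x y = G.diff f x y := fun y hy => by
      rw [diff_add, hk1 y hy, add_zero]
    have h2 : ∀ y ∈ G.nbr x, ∀ z ∈ G.nbr y, G.diff (f + k) y z = G.diff f y z :=
      fun y hy z hz => by rw [diff_add, hk2 y hy z hz, add_zero]
    have h3 := h (f + k) 0 (by simp [hk])
    rw [G.Γ_congr h1 h1, G.Γ₂_congr h1 h2, Γ_zero_left, Γ₂_zero] at h3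
    simpa using h3
  · intro g
    -- Here the parallel section is itself the partner of `g`; it contributes nothing to either
    -- form.
    obtain ⟨k, hk, hk1, hk2⟩ := LocallyBalanced.exists_parallel G hb (g x')
    have h1 : ∀ y ∈ G.nbr x, G.diff k x y = G.diff 0 x y := fun y hy => by
      rw [diff_zero, hk1 y hy]
    have h2 : ∀ y ∈ G.nbr x, ∀ z ∈ G.nbr y, G.diff k y z = G.diff 0 y z :=
      fun y hy z hz => by rw [diff_zero, hk2 y hy z hz]
    have h3 := h k g hk
    rw [G.Γ_congr h1 h1, G.Γ₂_congr h1 h2, Γ_zero_left, Γ₂_zero] at h3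
    simpa using h3

theorem CD_top_of_le {x : V} {K α : ℝ} (hα : 0 < α)
    (h : ∀ f, K * (α * RCLike.re (G.Γ f f x)) ≤ α ^ 2 * RCLike.re (G.Γ₂ f f x)) :
    G.CD x (K / α) ⊤ := by
  intro f
  have h1 := h f
  rw [ENNReal.inv_top, ENNReal.toReal_zero, zero_mul, zero_add, div_mul_eq_mul_div, div_le_iff₀ hα]
  refine le_of_mul_le_mul_left ?_ hα
  linarith

/-- Working strictly below the supremum covers infinite curvature and avoids any question of
attainment. -/
theorem exists_CD_of_lt {x : V} {N : ENNReal} {α c : ℝ} (hα : 0 < α)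
    (h : (c : EReal) < α * G.curvature x N) : ∃ K, G.CD x K N ∧ c ≤ α * K := by
  have h1 : ((c / α : ℝ) : EReal) < G.curvature x N := by
    rw [EReal.coe_div, EReal.div_lt_iff (by exact_mod_cast hα) (EReal.coe_ne_top _), mul_comm]
    exact h
  obtain ⟨_, ⟨K, hK, rfl⟩, hlt⟩ := lt_sSup_iff.mp h1
  refine ⟨K, hK, ?_⟩
  have h2 := (div_lt_iff₀ hα).1 (EReal.coe_lt_coe_iff.mp hlt)
  linarith

theorem le_mul_curvature {x : V} {N : ENNReal} {α K : ℝ} (hα : 0 < α) (h : G.CD x (K / α) N) :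
    (K : EReal) ≤ α * G.curvature x N := by
  have h1 : ((K / α : ℝ) : EReal) ≤ G.curvature x N := le_sSup ⟨_, h, rfl⟩
  calc (K : EReal) = α * ((K / α : ℝ) : EReal) := by
        rw [← EReal.coe_mul, mul_div_cancel₀ _ hα.ne']
    _ ≤ _ := mul_le_mul_of_nonneg_left h1 (by exact_mod_cast hα.le)

end Product

end ConnectionGraph

theorem mainTheorem8 {𝕜 : Type*} [RCLike 𝕜] {d : ℕ} {V V' : Type*}
    (G : ConnectionGraph 𝕜 d V) (G' : ConnectionGraph 𝕜 d V')
    (α β : ℝ) (hα : 0 < α) (hβ : 0 < β)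
    (hcomm : ∀ s ∈ G.signatureGroup, ∀ s' ∈ G'.signatureGroup, s * s' = s' * s)
    (x : V) (x' : V') :
    (∀ N N' : ENNReal, 0 < N → 0 < N' →
      (G.cart G' α β hα hβ).curvature (x, x') (N + N') ≥
        min ((α : EReal) * G.curvature x N) ((β : EReal) * G'.curvature x' N')) ∧
    (G.LocallyBalanced x ∨ G'.LocallyBalanced x' →
      (G.cart G' α β hα hβ).curvature (x, x') ⊤ =
        min ((α : EReal) * G.curvature x ⊤) ((β : EReal) * G'.curvature x' ⊤)) := by
  have hσ : ∀ y ∈ G.nbr x, ∀ y' ∈ G'.nbr x',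
      G.σ x y * G'.σ x' y' = G'.σ x' y' * G.σ x y := fun y hy y' hy' =>
    hcomm _ (Subgroup.subset_closure ⟨x, y, G.mem_nbr.1 hy, rfl⟩) _
      (Subgroup.subset_closure ⟨x', y', G'.mem_nbr.1 hy', rfl⟩)
  have hlower : ∀ N N' : ENNReal, 0 < N → 0 < N' →
      (G.cart G' α β hα hβ).curvature (x, x') (N + N') ≥
        min ((α : EReal) * G.curvature x N) ((β : EReal) * G'.curvature x' N') := by
    intro N N' hN hN'
    refine EReal.ge_of_forall_gt_iff_ge.1 fun c hc => ?_
    obtain ⟨K, hK, hcK⟩ := G.exists_CD_of_lt hα (hc.trans_le (min_le_left _ _))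
    obtain ⟨K', hK', hcK'⟩ := G'.exists_CD_of_lt hβ (hc.trans_le (min_le_right _ _))
    exact le_sSup ⟨c, G.cart_CD G' α β hα hβ hσ hN hN' hK hK' hcK hcK', rfl⟩
  refine ⟨hlower, fun hb => le_antisymm (sSup_le ?_) ?_⟩
  · rintro _ ⟨K, hK, rfl⟩
    have h := G.add_nonneg_of_cart_CD G' α β hα hβ hσ hK
    have h' : (∀ f, K * (α * RCLike.re (G.Γ f f x)) ≤ α ^ 2 * RCLike.re (G.Γ₂ f f x)) ∧
        ∀ g, K * (β * RCLike.re (G'.Γ g g x')) ≤ β ^ 2 * RCLike.re (G'.Γ₂ g g x') := by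
      rcases hb with hb | hb
      · exact hb.le_of_add G G' h
      · refine (hb.le_of_add G' G fun g f hgf => ?_).symm
        have := h f g hgf.symm
        linarith
    exact le_min (G.le_mul_curvature hα (G.CD_top_of_le hα h'.1))
      (G'.le_mul_curvature hβ (G'.CD_top_of_le hβ h'.2))
  · simpa using hlower ⊤ ⊤ (by simp) (by simp)
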